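/- Let $(X,\mathcal B,p)$ be a nonatomic probability space, i.e. every $A\in\mathcal B$ with $p(A)>0$ contains some $B\in\mathcal B$ with $0<p(B)<p(A)$ (for example, a nonatomic standard Lebesgue probability space). Let $\mathcal T$ be the set of invertible, bi-measurable, $p$-preserving maps $\tau:X\to X$, where maps that agree $p$-almost everywhere are identified, and give $\mathcal T$ the weak topology, i.e. the topology generated by the sets $\{\tau\in\mathcal T : p(\tau A\,\triangle\,\tau_0A)<\varepsilon\}$ with $A\in\mathcal B$, $\tau_0\in\mathcal T$ and $\varepsilon>0$. Let $1\le r\le\infty$ and let $f\in L_r(X)$, real- or complex-valued, be nonzero (not almost everywhere equal to $0$) with $\int_X f\,dp=0$. Then the set of those $\tau\in\mathcal T$ for which there is no $h\in L_1(X)$ with $f=h-h\circ\tau$ almost everywhere is a dense $G_\delta$ subset of $\mathcal T$. -/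

import Mathlib

open MeasureTheory Set Filter
open scoped ENNReal Topology

/-- A measure is nonatomic if every measurable set of positive measure has a measurable subset of
strictly smaller positive measure. -/
def IsNonatomic {X : Type*} [MeasurableSpace X] (p : Measure X) : Prop :=
  ∀ A : Set X, MeasurableSet A → 0 < p A →
    ∃ B : Set X, B ⊆ A ∧ MeasurableSet B ∧ 0 < p B ∧ p B < p A

/-- An invertible measure-preserving transformation of `(X, p)`: a bijection of `X`, measurable
together with its inverse, that preserves `p`. -/
structure MPTransformation {X : Type*} [MeasurableSpace X] (p : Measure X) where
  toEquiv : X ≃ᵐ X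
  measurePreserving : MeasurePreserving toEquiv p p

namespace MPTransformation

variable {X : Type*} [MeasurableSpace X] {p : Measure X}

/-- Transformations are identified when they agree almost everywhere. -/
instance aeSetoid (p : Measure X) : Setoid (MPTransformation p) where
  r σ τ := σ.toEquiv =ᵐ[p] τ.toEquiv
  iseqv := ⟨fun _ => EventuallyEq.rfl, fun h => h.symm, fun h₁ h₂ => h₁.trans h₂⟩

/-- The weak topology: it is generated by the sets
`{τ | p (τ A ∆ τ₀ A) < ε}` with `A` measurable and `ε > 0`. -/
instance weakTopology (p : Measure X) : TopologicalSpace (MPTransformation p) :=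
  TopologicalSpace.generateFrom
    {U | ∃ (A : Set X) (τ₀ : MPTransformation p) (ε : ℝ≥0∞), MeasurableSet A ∧ 0 < ε ∧
      U = {τ | p (symmDiff (τ.toEquiv '' A) (τ₀.toEquiv '' A)) < ε}}

end MPTransformation

/-- The space of invertible measure-preserving transformations of `(X, p)` modulo equality almost
everywhere. -/
def MPAut {X : Type*} [MeasurableSpace X] (p : Measure X) : Type _ :=
  Quotient (MPTransformation.aeSetoid p)

/-- The weak topology on classes of transformations. The sets generating the weak topology on
transformations are unions of classes, so this is the topology generated by their images. -/
instance MPAut.weakTopology {X : Type*} [MeasurableSpace X] (p : Measure X) :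
    TopologicalSpace (MPAut p) :=
  inferInstanceAs (TopologicalSpace (Quotient (MPTransformation.aeSetoid p)))

/-- `f` is a `τ`-coboundary with transfer function in `L_s`: there is `h ∈ L_s` with
`f = h - h ∘ τ` almost everywhere. -/
def IsCoboundary {X 𝕜 : Type*} [MeasurableSpace X] [RCLike 𝕜] {p : Measure X}
    (f : X → 𝕜) (s : ℝ≥0∞) (τ : MPTransformation p) : Prop :=
  ∃ h : X → 𝕜, MemLp h s p ∧ f =ᵐ[p] fun x => h x - h (τ.toEquiv x)

theorem IsCoboundary.congr {X 𝕜 : Type*} [MeasurableSpace X] [RCLike 𝕜] {p : Measure X}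
    {f : X → 𝕜} {s : ℝ≥0∞} {σ τ : MPTransformation p} (hστ : σ.toEquiv =ᵐ[p] τ.toEquiv)
    (hf : IsCoboundary f s σ) : IsCoboundary f s τ := by
  obtain ⟨h, hh, he⟩ := hf
  refine ⟨h, hh, ?_⟩
  filter_upwards [he, hστ] with x hx hx'
  rw [hx, hx']

/-- Being a coboundary depends only on the class of the transformation. -/
def MPAut.IsCoboundary {X 𝕜 : Type*} [MeasurableSpace X] [RCLike 𝕜] {p : Measure X}
    (f : X → 𝕜) (s : ℝ≥0∞) (T : MPAut p) : Prop :=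
  Quotient.lift (s := MPTransformation.aeSetoid p) (fun τ => _root_.IsCoboundary f s τ)
    (fun _ _ hστ => propext ⟨fun h => h.congr hστ, fun h => h.congr (EventuallyEq.symm hστ)⟩) T

/-!
For an integrable `f`, put `S_n = f + f ∘ τ + ⋯ + f ∘ τ^(n-1)`.

*The set is a `Gδ`.* The function `f` is a `τ`-coboundary with integrable transfer function if and
only if `sup_n ‖S_n‖₁ < ∞` (`isCoboundary_one_iff`). Since `τ ↦ f ∘ τ^n` is continuous from the weak
topology to `L¹`, each set `{τ | ∀ n, ‖S_n‖₁ ≤ K}` is closed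
(`MPTransformation.isClosed_birkhoffSum_le`), so the coboundary condition defines an `Fσ`.

If `f = h - h ∘ τ`, then `‖S_n‖₁ ≤ 2 ‖h‖₁`. The converse
(`exists_transfer_of_birkhoffSum_bounded`) is a fixed point problem for the affine isometry
`h ↦ h ∘ τ + f`, whose orbit of `0` is `S_n`. As `L¹` is not reflexive, the problem is moved to a
Hilbert space: `h` is replaced by its subgraph `{t < h x}`, that is, by the function
`1_{t < h x} - 1_{t < 0}` in `L²(X × ℝ)`, whose squared norm is `‖h‖₁`. The isometry becomes
composition with the skew product `(x, t) ↦ (τ x, t - f x)` followed by a translation. In the Hilbert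
space a bounded orbit yields a fixed point (`exists_affine_fixedPoint_of_bounded_orbit`), hence a
function `G` on `X × ℝ`, invariant under the skew product and at finite `L²`-distance
from `1_{t < 0}`. Its level set `{G > 1/2}` is invariant too, and the signed length of the fibres of
this set relative to `{t < 0}` is the transfer function.

*The set is dense.* Let `f = h - h ∘ τ`. Since `h` and `h ∘ τ` differ where `f` does not vanish,
there is a set `A` of positive measure, disjoint from `τ⁻¹ A`, on which `f` does not vanish; by
nonatomicity its measure can be taken small. Exchanging `A` and `τ⁻¹ A` by `τ` and then applying `τ`
gives a transformation that is the identity on `A` and agrees with `τ` off `A ∪ τ⁻¹ A`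
(`MPTransformation.exists_eq_id_on`). It is close to `τ`, and `f` is not a coboundary for it,
because such a coboundary vanishes at fixed points.
-/

/-! ### Fixed points of affine isometries of a Hilbert space -/

/-- An affine map of a Hilbert space with bounded linear part has a fixed point as soon as the orbit
of `0` is bounded: a weak limit of the averages of the orbit is one. -/
theorem exists_affine_fixedPoint_of_bounded_orbit {H : Type*} [NormedAddCommGroup H]
    [InnerProductSpace ℝ H] [CompleteSpace H] (U : H →L[ℝ] H) (b : H) (C : ℝ)
    (hC : ∀ n : ℕ, ‖(fun v => U v + b)^[n] 0‖ ≤ C) : ∃ a, U a + b = a := by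
  set s : ℕ → H := fun n => (fun v => U v + b)^[n] 0 with hs
  have hs0 : s 0 = 0 := rfl
  have hsucc : ∀ n, U (s n) + b = s (n + 1) := fun n => by
    simp only [hs, Function.iterate_succ_apply']
  set avg : ℕ → H := fun N => ((N : ℝ) + 1)⁻¹ • ∑ n ∈ Finset.range (N + 1), s n with havg
  have hpos : ∀ N : ℕ, (0 : ℝ) < (N : ℝ) + 1 := fun N => by positivity
  have hbound : ∀ N, ‖avg N‖ ≤ C := by
    intro N
    simp only [havg, norm_smul, norm_inv, Real.norm_of_nonneg (hpos N).le]
    rw [inv_mul_le_iff₀ (hpos N)]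
    refine (norm_sum_le _ _).trans ((Finset.sum_le_sum fun n _ => hC n).trans ?_)
    simp
  have hdiff : ∀ N, U (avg N) + b - avg N = ((N : ℝ) + 1)⁻¹ • s (N + 1) := by
    intro N
    have h1 : b = ((N : ℝ) + 1)⁻¹ • ∑ n ∈ Finset.range (N + 1), b := by
      rw [Finset.sum_const, Finset.card_range, ← Nat.cast_smul_eq_nsmul ℝ, smul_smul]
      push_cast
      rw [inv_mul_cancel₀ (hpos N).ne', one_smul]
    have h2 : ∑ n ∈ Finset.range (N + 1), (U (s n) + b - s n) = s (N + 1) := by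
      simp_rw [hsucc, Finset.sum_range_sub, hs0, sub_zero]
    rw [← h2, Finset.sum_sub_distrib, Finset.sum_add_distrib, smul_sub, smul_add, ← h1]
    simp only [havg, map_smul, map_sum]
  have hdiff0 : Tendsto (fun N => U (avg N) + b - avg N) atTop (𝓝 0) := by
    refine squeeze_zero_norm (a := fun N : ℕ => C * (1 / ((N : ℝ) + 1))) (fun N => ?_) ?_
    · rw [hdiff, norm_smul, norm_inv, Real.norm_of_nonneg (hpos N).le, mul_comm, one_div]
      exact mul_le_mul_of_nonneg_right (hC _) (inv_nonneg.2 (hpos N).le)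
    · simpa using tendsto_one_div_add_atTop_nhds_zero_nat.const_mul C
  -- A weak limit of the averages along an ultrafilter, by the Banach–Alaoglu theorem.
  let u : ℕ → WeakDual ℝ H := fun N =>
    StrongDual.toWeakDual (InnerProductSpace.toDual ℝ H (avg N))
  obtain ⟨x, -, hx⟩ := (WeakDual.isCompact_closedBall (𝕜 := ℝ) (E := H) 0 C).ultrafilter_le_nhds'
    ((hyperfilter ℕ).map u) (by
      refine Filter.mem_map.2 (univ_mem' fun N => ?_)
      simpa [u] using hbound N)
  have hxt : Tendsto u (hyperfilter ℕ) (𝓝 x) := hx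
  obtain ⟨a, ha⟩ := (InnerProductSpace.toDual ℝ H).surjective (WeakDual.toStrongDual x)
  have hlim : ∀ v : H, Tendsto (fun N => inner ℝ (avg N) v) (hyperfilter ℕ : Filter ℕ)
      (𝓝 (inner ℝ a v)) := by
    intro v
    have h1 := ((WeakDual.eval_continuous (𝕜 := ℝ) v).tendsto x).comp hxt
    have h2 : x v = inner ℝ a v := by
      rw [← InnerProductSpace.toDual_apply_apply (𝕜 := ℝ), ha]
      rfl
    rw [← h2]
    exact h1
  refine ⟨a, ext_inner_right ℝ fun v => ?_⟩
  have h1 := (hlim (ContinuousLinearMap.adjoint U v)).add_const (inner ℝ b v) |>.sub (hlim v)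
  have h2 : Tendsto (fun N => inner ℝ (U (avg N) + b - avg N) v) (hyperfilter ℕ : Filter ℕ)
      (𝓝 (inner ℝ (0 : H) v)) :=
    (hdiff0.mono_left Nat.hyperfilter_le_atTop).inner tendsto_const_nhds
  have h3 := tendsto_nhds_unique h1 (h2.congr fun N => by
    rw [inner_sub_left, inner_add_left, ContinuousLinearMap.adjoint_inner_right])
  rw [ContinuousLinearMap.adjoint_inner_right, inner_zero_left] at h3
  rw [inner_add_left]
  linarith

/-! ### Signed intervals -/

/-- The function `1_{t < a} - 1_{t < 0}` of `t`: the signed indicator of the interval between `0`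
and `a`. -/
noncomputable def signedInterval (a t : ℝ) : ℝ := (Iio a).indicator 1 t - (Iio 0).indicator 1 t

theorem signedInterval_zero (t : ℝ) : signedInterval 0 t = 0 := sub_self _

/-- Translating the interval of `b` by `a` and adding the interval of `a` gives the interval
of `b + a`. -/
theorem signedInterval_sub_add (a b t : ℝ) :
    signedInterval b (t - a) + signedInterval a t = signedInterval (b + a) t := by
  simp only [signedInterval, indicator_apply, mem_Iio, sub_lt_iff_lt_add, zero_add, Pi.one_apply]
  ring

theorem measurable_signedInterval : Measurable (Function.uncurry signedInterval) := by
  refine Measurable.sub ?_ ?_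
  · exact (measurable_const (a := (1 : ℝ))).indicator
      (measurableSet_lt measurable_snd measurable_fst)
  · exact ((measurable_const (a := (1 : ℝ))).indicator measurableSet_Iio).comp measurable_snd

theorem signedInterval_of_nonneg {a : ℝ} (ha : 0 ≤ a) :
    signedInterval a = (Ico 0 a).indicator fun _ => 1 := by
  ext t
  simp only [signedInterval, indicator_apply, mem_Iio, mem_Ico, Pi.one_apply]
  split_ifs <;> grind

theorem signedInterval_of_nonpos {a : ℝ} (ha : a ≤ 0) :
    signedInterval a = (Ico a 0).indicator fun _ => -1 := by
  ext t
  simp only [signedInterval, indicator_apply, mem_Iio, mem_Ico, Pi.one_apply]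
  split_ifs <;> grind

theorem integrable_signedInterval (a : ℝ) : Integrable (signedInterval a) := by
  rcases le_total 0 a with ha | ha
  · rw [signedInterval_of_nonneg ha]
    exact (integrable_indicator_iff measurableSet_Ico).2 (integrableOn_const (by simp))
  · rw [signedInterval_of_nonpos ha]
    exact (integrable_indicator_iff measurableSet_Ico).2 (integrableOn_const (by simp))

theorem integral_signedInterval (a : ℝ) : ∫ t, signedInterval a t = a := by
  rcases le_total 0 a with ha | ha
  · simp [signedInterval_of_nonneg ha, integral_indicator measurableSet_Ico, ha]
  · simp [signedInterval_of_nonpos ha, integral_indicator measurableSet_Ico, ha]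

theorem lintegral_sq_signedInterval (a : ℝ) : ∫⁻ t, ‖signedInterval a t‖ₑ ^ 2 = ‖a‖ₑ := by
  rcases le_total 0 a with ha | ha
  · have : ∀ t, ‖signedInterval a t‖ₑ ^ 2 = (Ico 0 a).indicator 1 t := fun t => by
      by_cases ht : t ∈ Ico 0 a <;> simp [signedInterval_of_nonneg ha, ht]
    simp_rw [this]
    rw [lintegral_indicator_one measurableSet_Ico, Real.volume_Ico, sub_zero,
      Real.enorm_eq_ofReal ha]
  · have : ∀ t, ‖signedInterval a t‖ₑ ^ 2 = (Ico a 0).indicator 1 t := fun t => by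
      by_cases ht : t ∈ Ico a 0 <;> simp [signedInterval_of_nonpos ha, ht]
    simp_rw [this]
    rw [lintegral_indicator_one measurableSet_Ico, Real.volume_Ico, zero_sub,
      ← enorm_neg, Real.enorm_eq_ofReal (neg_nonneg.2 ha)]

/-- The set where a function exceeds `1/2` differs from a half-line by at most `4` times the square
of the distance between the function and the indicator of the half-line. -/
theorem abs_level_sub_indicator_le (y t : ℝ) :
    |(Ioi (1 / 2 : ℝ)).indicator 1 (y + (Iio 0).indicator 1 t) - (Iio (0 : ℝ)).indicator 1 t|
      ≤ 4 * y ^ 2 := by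
  by_cases ht : t < 0 <;> simp only [indicator_apply, mem_Iio, mem_Ioi, ht, if_true, if_false,
    Pi.one_apply] <;> split_ifs with h <;> norm_num <;> nlinarith

/-! ### Skew products and transfer functions -/

theorem birkhoffSum_comp_add {X : Type*} (τ : X → X) (f : X → ℝ) (n : ℕ) (x : X) :
    birkhoffSum τ f n (τ x) + f x = birkhoffSum τ f (n + 1) x := by
  rw [birkhoffSum_succ', add_comm]

section SkewProduct

variable {X : Type*} [MeasurableSpace X] {p : Measure X}

/-- The subgraph `{t < h x}` is at squared `L²`-distance `‖h‖₁` from the half-space `{t < 0}`. -/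
theorem eLpNorm_signedInterval [SFinite p] {h : X → ℝ} (hh : Measurable h) :
    eLpNorm (fun z : X × ℝ => signedInterval (h z.1) z.2) 2 (p.prod volume) ^ 2
      = eLpNorm h 1 p := by
  have hm : Measurable fun z : X × ℝ => signedInterval (h z.1) z.2 :=
    measurable_signedInterval.comp ((hh.comp measurable_fst).prodMk measurable_snd)
  have := eLpNorm_nnreal_pow_eq_lintegral (μ := p.prod volume) (p := 2) two_ne_zero
    (f := fun z : X × ℝ => signedInterval (h z.1) z.2)
  norm_num at this
  rw [this, lintegral_prod _ (hm.enorm.pow_const 2).aemeasurable, eLpNorm_one_eq_lintegral_enorm]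
  simp_rw [lintegral_sq_signedInterval]

/-- The skew product `(x, t) ↦ (τ x, t - f x)` preserves `p × dt`. -/
theorem measurePreserving_skew_sub [SFinite p] {τ : X → X} (hτ : MeasurePreserving τ p p)
    {f : X → ℝ} (hf : Measurable f) :
    MeasurePreserving (fun z : X × ℝ => (τ z.1, z.2 - f z.1)) (p.prod volume) (p.prod volume) :=
  hτ.skew_product (g := fun x t => t - f x)
    (measurable_snd.sub (hf.comp measurable_fst))
    (Eventually.of_forall fun x => (measurePreserving_sub_right volume (f x)).map_eq)

/-- If the Birkhoff sums of `f` are bounded in `L¹`, the half-space `{t < 0}` is at finite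
`L²`-distance from a function invariant under the skew product `(x, t) ↦ (τ x, t - f x)`. -/
theorem exists_skew_invariant [IsProbabilityMeasure p] {τ : X → X} (hτ : MeasurePreserving τ p p)
    {f : X → ℝ} (hf : Measurable f) {K : ℝ≥0∞} (hK : K ≠ ∞)
    (hb : ∀ n, eLpNorm (birkhoffSum τ f n) 1 p ≤ K) :
    ∃ F : X × ℝ → ℝ, Measurable F ∧ MemLp F 2 (p.prod volume) ∧
      ∀ᵐ z ∂(p.prod volume), F (τ z.1, z.2 - f z.1) + signedInterval (f z.1) z.2 = F z := by
  have hθ := measurePreserving_skew_sub hτ hf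
  set θ : X × ℝ → X × ℝ := fun z => (τ z.1, z.2 - f z.1) with hθdef
  have hS : ∀ n, Measurable (birkhoffSum τ f n) := fun n =>
    Finset.measurable_sum _ fun k _ => hf.comp (hτ.measurable.iterate k)
  have hSm : ∀ n, Measurable fun z : X × ℝ => signedInterval (birkhoffSum τ f n z.1) z.2 :=
    fun n => measurable_signedInterval.comp (((hS n).comp measurable_fst).prodMk measurable_snd)
  have hSK : ∀ n, eLpNorm (fun z : X × ℝ => signedInterval (birkhoffSum τ f n z.1) z.2) 2
      (p.prod volume) ^ 2 ≤ K := fun n => by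
    rw [eLpNorm_signedInterval (hS n)]
    exact hb n
  have hSL : ∀ n, MemLp (fun z : X × ℝ => signedInterval (birkhoffSum τ f n z.1) z.2) 2
      (p.prod volume) := fun n => by
    refine ⟨(hSm n).aestronglyMeasurable, ?_⟩
    have := (hSK n).trans_lt hK.lt_top
    rwa [ENNReal.pow_lt_top_iff, or_iff_left two_ne_zero] at this
  let e : ℕ → Lp ℝ 2 (p.prod (volume : Measure ℝ)) := fun n => (hSL n).toLp
  let U := (Lp.compMeasurePreservingₗᵢ (E := ℝ) (p := 2) ℝ θ hθ).toContinuousLinearMap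
  have hU : ∀ v, U v =ᵐ[p.prod volume] v ∘ θ := fun v => Lp.coeFn_compMeasurePreserving v hθ
  -- The orbit of `0` consists of the subgraphs of the Birkhoff sums.
  have he : ∀ n, (fun v => U v + e 1)^[n] 0 = e n := by
    intro n
    induction n with
    | zero =>
      refine Lp.ext ?_
      filter_upwards [Lp.coeFn_zero ℝ 2 (p.prod (volume : Measure ℝ)), (hSL 0).coeFn_toLp]
        with z h1 h2
      simp only [Function.iterate_zero, id_eq, e]
      rw [h1, h2]
      simp [signedInterval_zero]
    | succ n ih =>
      rw [Function.iterate_succ_apply', ih]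
      refine Lp.ext ?_
      filter_upwards [Lp.coeFn_add (U (e n)) (e 1), hU (e n),
        hθ.quasiMeasurePreserving.ae_eq_comp (hSL n).coeFn_toLp, (hSL 1).coeFn_toLp,
        (hSL (n + 1)).coeFn_toLp] with z h1 h2 h3 h4 h5
      rw [h1, Pi.add_apply, h2, h3, h4, h5]
      simp only [Function.comp_apply, hθdef, birkhoffSum_one, signedInterval_sub_add,
        birkhoffSum_comp_add]
  obtain ⟨F, hF⟩ := exists_affine_fixedPoint_of_bounded_orbit U (e 1) (K.toReal + 1) (by
    intro n
    rw [he n, Lp.norm_toLp]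
    have h1 : (eLpNorm (fun z : X × ℝ => signedInterval (birkhoffSum τ f n z.1) z.2) 2
        (p.prod volume)).toReal ^ 2 ≤ K.toReal := by
      rw [← ENNReal.toReal_pow]
      exact ENNReal.toReal_mono hK (hSK n)
    nlinarith [sq_nonneg ((eLpNorm (fun z : X × ℝ => signedInterval (birkhoffSum τ f n z.1) z.2) 2
        (p.prod volume)).toReal - 1)])
  have hFm := (Lp.stronglyMeasurable F).measurable
  refine ⟨F, hFm, Lp.memLp F, ?_⟩
  filter_upwards [Lp.coeFn_add (U F) (e 1), hU F, (hSL 1).coeFn_toLp] with z h1 h2 h3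
  rw [hF, Pi.add_apply, h2, h3] at h1
  simpa using h1.symm

/-- A function whose Birkhoff sums are bounded in `L¹` is a coboundary with an integrable transfer
function. The transfer function is read off from the level set `{G > 1/2}` of a function `G` on
`X × ℝ` invariant under the skew product, as the signed length of its fibres relative
to `{t < 0}`. -/
theorem exists_transfer_of_birkhoffSum_bounded [IsProbabilityMeasure p] {τ : X → X}
    (hτ : MeasurePreserving τ p p) {f : X → ℝ} (hf : Measurable f) {K : ℝ≥0∞} (hK : K ≠ ∞)
    (hb : ∀ n, eLpNorm (birkhoffSum τ f n) 1 p ≤ K) :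
    ∃ h : X → ℝ, MemLp h 1 p ∧ f =ᵐ[p] fun x => h x - h (τ x) := by
  obtain ⟨F, hFm, hF2, hFe⟩ := exists_skew_invariant hτ hf hK hb
  -- `G = F + 1_{t < 0}` is invariant, and `D = 1_{G > 1/2} - 1_{t < 0}`.
  let D : X × ℝ → ℝ := fun z =>
    (Ioi (1 / 2 : ℝ)).indicator 1 (F z + (Iio 0).indicator 1 z.2) - (Iio (0 : ℝ)).indicator 1 z.2
  have hI : Measurable ((Iio (0 : ℝ)).indicator (1 : ℝ → ℝ)) :=
    measurable_one.indicator measurableSet_Iio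
  have hI' : Measurable ((Ioi (1 / 2 : ℝ)).indicator (1 : ℝ → ℝ)) :=
    measurable_one.indicator measurableSet_Ioi
  have hDm : Measurable D :=
    (hI'.comp (hFm.add (hI.comp measurable_snd))).sub (hI.comp measurable_snd)
  have hDi : Integrable D (p.prod volume) := by
    refine (hF2.integrable_sq.const_mul 4).mono' hDm.aestronglyMeasurable
      (Eventually.of_forall fun z => ?_)
    exact abs_level_sub_indicator_le (F z) z.2
  have hDe : ∀ᵐ z ∂(p.prod volume), D (τ z.1, z.2 - f z.1) + signedInterval (f z.1) z.2 = D z := by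
    filter_upwards [hFe] with z hz
    have h1 : (Iio (0 : ℝ)).indicator (1 : ℝ → ℝ) (z.2 - f z.1)
        = (Iio (f z.1)).indicator 1 z.2 := by
      simp only [indicator_apply, mem_Iio, sub_lt_iff_lt_add, zero_add, Pi.one_apply]
    simp only [D, h1, ← hz, signedInterval]
    rw [← add_sub_assoc, sub_add_cancel, add_sub_assoc', sub_add_cancel]
  refine ⟨fun x => ∫ t, D (x, t), memLp_one_iff_integrable.2 hDi.integral_prod_left, ?_⟩
  have hfib := hDi.prod_right_ae
  filter_upwards [hfib, hτ.quasiMeasurePreserving.ae hfib, Measure.ae_ae_of_ae_prod hDe]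
    with x h1 h2 h3
  have h4 : ∫ t, D (x, t) = (∫ t, D (τ x, t)) + f x := by
    rw [← integral_congr_ae h3, integral_add (h2.comp_sub_right (f x))
      (integrable_signedInterval (f x)), integral_signedInterval,
      integral_sub_right_eq_self (fun t => D (τ x, t))]
  rw [h4]
  ring

end SkewProduct

/-! ### The weak topology -/

namespace MPTransformation

variable {X 𝕜 : Type*} [MeasurableSpace X] [RCLike 𝕜] {p : Measure X}

theorem measure_image (τ : MPTransformation p) (A : Set X) : p (τ.toEquiv '' A) = p A := by
  rw [← τ.measurePreserving.measure_preimage_equiv, τ.toEquiv.injective.preimage_image]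

theorem measure_symmDiff_image_le {σ τ : MPTransformation p} {S : Set X}
    (h : ∀ x ∉ S, σ.toEquiv x = τ.toEquiv x) (A : Set X) :
    p (symmDiff (σ.toEquiv '' A) (τ.toEquiv '' A)) ≤ 2 * p S := by
  have hsub : symmDiff (σ.toEquiv '' A) (τ.toEquiv '' A) ⊆ σ.toEquiv '' S ∪ τ.toEquiv '' S := by
    rintro y (⟨⟨x, hx, rfl⟩, hy⟩ | ⟨⟨x, hx, rfl⟩, hy⟩)
    · refine Or.inl ⟨x, ?_, rfl⟩
      by_contra hS
      exact hy ⟨x, hx, (h x hS).symm⟩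
    · refine Or.inr ⟨x, ?_, rfl⟩
      by_contra hS
      exact hy ⟨x, hx, h x hS⟩
  calc _ ≤ _ := measure_mono hsub
    _ ≤ _ := measure_union_le _ _
    _ = 2 * p S := by rw [measure_image, measure_image, two_mul]

/-- Transformations that agree off sets of measure tending to `0` converge weakly. -/
theorem tendsto_of_agree_off {ι : Type*} {l : Filter ι} {τ : ι → MPTransformation p}
    {τ₀ : MPTransformation p} {S : ι → Set X}
    (h : ∀ i, ∀ x ∉ S i, (τ i).toEquiv x = τ₀.toEquiv x)
    (hS : Tendsto (fun i => p (S i)) l (𝓝 0)) : Tendsto τ l (𝓝 τ₀) := by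
  refine TopologicalSpace.tendsto_nhds_generateFrom_iff.2 ?_
  rintro _ ⟨A, σ, ε, -, -, rfl⟩ hτ₀
  have h1 : Tendsto (fun i => 2 * p (S i) + p (symmDiff (τ₀.toEquiv '' A) (σ.toEquiv '' A))) l
      (𝓝 (2 * 0 + p (symmDiff (τ₀.toEquiv '' A) (σ.toEquiv '' A)))) :=
    (ENNReal.Tendsto.const_mul hS (Or.inr (by simp))).add_const _
  rw [mul_zero, zero_add] at h1
  filter_upwards [h1.eventually (gt_mem_nhds hτ₀)] with i hi
  exact ((measure_symmDiff_le _ (τ₀.toEquiv '' A) _).trans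
    (add_le_add_left (measure_symmDiff_image_le (h i) A) _)).trans_lt hi

/-- The weak topology does not separate transformations that agree almost everywhere, so its open and
closed sets are unions of classes. -/
theorem inseparable_of_ae_eq {σ τ : MPTransformation p} (h : σ.toEquiv =ᵐ[p] τ.toEquiv) :
    Inseparable σ τ := by
  have key : ∀ {σ τ : MPTransformation p}, σ.toEquiv =ᵐ[p] τ.toEquiv → σ ⤳ τ := by
    intro σ τ h
    rw [specializes_iff_pure, ← tendsto_id']
    have := tendsto_of_agree_off (l := pure σ) (τ := id) (τ₀ := τ)
      (S := fun ρ => {x | ρ.toEquiv x ≠ τ.toEquiv x}) (fun ρ x hx => not_not.1 hx)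
      (tendsto_pure_left.2 fun s hs => by
        have h0 : p {x | σ.toEquiv x ≠ τ.toEquiv x} = 0 := h
        rw [h0]; exact mem_of_mem_nhds hs)
    exact this
  exact (key h).antisymm (key h.symm)

theorem tendsto_measure_symmDiff_preimage (τ₀ : MPTransformation p) {A : Set X}
    (hA : MeasurableSet A) :
    Tendsto (fun τ : MPTransformation p => p (symmDiff (τ.toEquiv ⁻¹' A) (τ₀.toEquiv ⁻¹' A)))
      (𝓝 τ₀) (𝓝 0) := by
  -- Applying `τ` turns `τ⁻¹ A ∆ τ₀⁻¹ A` into `τ₀ C ∆ τ C` with `C = τ₀⁻¹ A`.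
  have h1 : ∀ τ : MPTransformation p, p (symmDiff (τ.toEquiv ⁻¹' A) (τ₀.toEquiv ⁻¹' A))
      = p (symmDiff (τ.toEquiv '' (τ₀.toEquiv ⁻¹' A)) (τ₀.toEquiv '' (τ₀.toEquiv ⁻¹' A))) := by
    intro τ
    rw [← τ.measure_image, image_symmDiff τ.toEquiv.injective,
      image_preimage_eq _ τ.toEquiv.surjective, image_preimage_eq _ τ₀.toEquiv.surjective,
      symmDiff_comm]
  simp_rw [h1]
  refine ENNReal.tendsto_nhds_zero.2 fun ε hε => ?_
  have hU : IsOpen {τ : MPTransformation p | p (symmDiff (τ.toEquiv '' (τ₀.toEquiv ⁻¹' A))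
      (τ₀.toEquiv '' (τ₀.toEquiv ⁻¹' A))) < ε} :=
    TopologicalSpace.isOpen_generateFrom_of_mem
      ⟨_, τ₀, ε, τ₀.toEquiv.measurable hA, hε, rfl⟩
  filter_upwards [hU.mem_nhds (by simpa using hε)] with τ hτ
  exact le_of_lt hτ

/-- Koopman operators depend continuously on the transformation, in the strong operator topology of
`L¹`. -/
theorem tendsto_eLpNorm_comp_sub (τ₀ : MPTransformation p) {E : Type*} [NormedAddCommGroup E]
    {g : X → E} (hg : MemLp g 1 p) :
    Tendsto (fun τ : MPTransformation p => eLpNorm (g ∘ τ.toEquiv - g ∘ τ₀.toEquiv) 1 p)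
      (𝓝 τ₀) (𝓝 0) := by
  have hcomp : ∀ {u : X → E}, AEStronglyMeasurable u p → ∀ τ : MPTransformation p,
      AEStronglyMeasurable (u ∘ τ.toEquiv) p := fun hu τ =>
    hu.comp_measurePreserving τ.measurePreserving
  refine ENNReal.tendsto_nhds_zero.2 fun ε hε => ?_
  obtain ⟨u, hu, hut, hum⟩ := MemLp.induction_dense (p := 1) (μ := p) (E := E) ENNReal.one_ne_top
    (fun u => Tendsto (fun τ : MPTransformation p =>
      eLpNorm (u ∘ τ.toEquiv - u ∘ τ₀.toEquiv) 1 p) (𝓝 τ₀) (𝓝 0) ∧ AEStronglyMeasurable u p)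
    (fun c s hs _ ε _ => ⟨s.indicator fun _ => c, by simp, by
      have h1 : Tendsto (fun τ : MPTransformation p =>
          ‖c‖ₑ * p (symmDiff (τ.toEquiv ⁻¹' s) (τ₀.toEquiv ⁻¹' s))) (𝓝 τ₀) (𝓝 (‖c‖ₑ * 0)) :=
        ENNReal.Tendsto.const_mul (tendsto_measure_symmDiff_preimage τ₀ hs) (Or.inr (by simp))
      rw [mul_zero] at h1
      refine tendsto_of_tendsto_of_tendsto_of_le_of_le tendsto_const_nhds h1
        (fun _ => zero_le) fun τ => ?_
      have hm : MeasurableSet (symmDiff (τ.toEquiv ⁻¹' s) (τ₀.toEquiv ⁻¹' s)) :=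
        (τ.toEquiv.measurable hs).symmDiff (τ₀.toEquiv.measurable hs)
      simp only
      rw [eLpNorm_one_eq_lintegral_enorm, ← lintegral_indicator_const hm]
      refine lintegral_mono fun x => ?_
      by_cases h1 : τ.toEquiv x ∈ s <;> by_cases h2 : τ₀.toEquiv x ∈ s <;>
        simp [indicator, mem_symmDiff, h1, h2],
      (stronglyMeasurable_const.indicator hs).aestronglyMeasurable⟩)
    (fun u v hu hv => ⟨by
      have h1 := hu.1.add hv.1
      rw [add_zero] at h1
      refine tendsto_of_tendsto_of_tendsto_of_le_of_le tendsto_const_nhds h1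
        (fun _ => zero_le) fun τ => ?_
      have h2 : (u + v) ∘ τ.toEquiv - (u + v) ∘ τ₀.toEquiv
          = (u ∘ τ.toEquiv - u ∘ τ₀.toEquiv) + (v ∘ τ.toEquiv - v ∘ τ₀.toEquiv) := by
        ext x; simp only [Pi.sub_apply, Pi.add_apply, Function.comp_apply]; abel
      simp only
      rw [h2]
      exact eLpNorm_add_le ((hcomp hu.2 τ).sub (hcomp hu.2 τ₀))
        ((hcomp hv.2 τ).sub (hcomp hv.2 τ₀)) le_rfl, hu.2.add hv.2⟩)
    (fun u hu => hu.2) hg (ε := ε / 3) (ENNReal.div_pos hε.ne' (by simp)).ne'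
  filter_upwards [ENNReal.tendsto_nhds_zero.1 hut (ε / 3) (ENNReal.div_pos hε.ne' (by simp))]
    with τ hτ
  have hgu := hg.aestronglyMeasurable.sub hum
  have h1 : g ∘ τ.toEquiv - g ∘ τ₀.toEquiv = ((g - u) ∘ τ.toEquiv
      + (u ∘ τ.toEquiv - u ∘ τ₀.toEquiv)) - (g - u) ∘ τ₀.toEquiv := by
    ext x; simp only [Pi.sub_apply, Pi.add_apply, Function.comp_apply]; abel
  calc _ ≤ eLpNorm ((g - u) ∘ τ.toEquiv) 1 p
        + eLpNorm (u ∘ τ.toEquiv - u ∘ τ₀.toEquiv) 1 p + eLpNorm ((g - u) ∘ τ₀.toEquiv) 1 p := by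
        rw [h1]
        refine (eLpNorm_sub_le ((hcomp hgu τ).add ((hcomp hum τ).sub (hcomp hum τ₀)))
          (hcomp hgu τ₀) le_rfl).trans (add_le_add_left ?_ _)
        exact eLpNorm_add_le (hcomp hgu τ) ((hcomp hum τ).sub (hcomp hum τ₀)) le_rfl
    _ ≤ ε / 3 + ε / 3 + ε / 3 := by
        rw [eLpNorm_comp_measurePreserving hgu τ.measurePreserving,
          eLpNorm_comp_measurePreserving hgu τ₀.measurePreserving]
        exact add_le_add (add_le_add hu hτ) hu
    _ = ε := ENNReal.add_thirds ε

theorem memLp_comp_iterate (τ : MPTransformation p) {f : X → 𝕜} (hf : MemLp f 1 p) (n : ℕ) :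
    MemLp (f ∘ τ.toEquiv^[n]) 1 p :=
  hf.comp_measurePreserving (τ.measurePreserving.iterate n)

theorem memLp_birkhoffSum (τ : MPTransformation p) {f : X → 𝕜} (hf : MemLp f 1 p) (n : ℕ) :
    MemLp (birkhoffSum τ.toEquiv f n) 1 p :=
  memLp_finsetSum (Finset.range n) fun k _ => τ.memLp_comp_iterate hf k

theorem tendsto_eLpNorm_comp_iterate_sub (τ₀ : MPTransformation p) {f : X → 𝕜}
    (hf : MemLp f 1 p) (n : ℕ) :
    Tendsto (fun τ : MPTransformation p => eLpNorm (f ∘ τ.toEquiv^[n] - f ∘ τ₀.toEquiv^[n]) 1 p)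
      (𝓝 τ₀) (𝓝 0) := by
  induction n with
  | zero => simp
  | succ n ih =>
    have h1 := ih.add (tendsto_eLpNorm_comp_sub τ₀ (τ₀.memLp_comp_iterate hf n))
    rw [add_zero] at h1
    refine tendsto_of_tendsto_of_tendsto_of_le_of_le tendsto_const_nhds h1
      (fun _ => zero_le) fun τ => ?_
    have hm := (τ.memLp_comp_iterate hf n).sub (τ₀.memLp_comp_iterate hf n)
    have h2 : f ∘ τ.toEquiv^[n + 1] - f ∘ τ₀.toEquiv^[n + 1]
        = (f ∘ τ.toEquiv^[n] - f ∘ τ₀.toEquiv^[n]) ∘ τ.toEquiv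
          + ((f ∘ τ₀.toEquiv^[n]) ∘ τ.toEquiv - (f ∘ τ₀.toEquiv^[n]) ∘ τ₀.toEquiv) := by
      ext x; simp
    simp only
    rw [h2, ← eLpNorm_comp_measurePreserving hm.aestronglyMeasurable τ.measurePreserving]
    have h3 := τ₀.memLp_comp_iterate hf n
    exact eLpNorm_add_le (hm.aestronglyMeasurable.comp_measurePreserving τ.measurePreserving)
      ((h3.comp_measurePreserving τ.measurePreserving).sub
        (h3.comp_measurePreserving τ₀.measurePreserving)).aestronglyMeasurable le_rfl

theorem tendsto_eLpNorm_birkhoffSum_sub (τ₀ : MPTransformation p) {f : X → 𝕜}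
    (hf : MemLp f 1 p) (n : ℕ) :
    Tendsto (fun τ : MPTransformation p =>
      eLpNorm (birkhoffSum τ.toEquiv f n - birkhoffSum τ₀.toEquiv f n) 1 p) (𝓝 τ₀) (𝓝 0) := by
  have h1 := tendsto_finsetSum (Finset.range n) fun k _ =>
    tendsto_eLpNorm_comp_iterate_sub τ₀ hf k
  rw [Finset.sum_const_zero] at h1
  refine tendsto_of_tendsto_of_tendsto_of_le_of_le tendsto_const_nhds h1
    (fun _ => zero_le) fun τ => ?_
  have h2 : birkhoffSum τ.toEquiv f n - birkhoffSum τ₀.toEquiv f n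
      = ∑ k ∈ Finset.range n, (f ∘ τ.toEquiv^[k] - f ∘ τ₀.toEquiv^[k]) := by
    ext x; simp [birkhoffSum]
  simp only
  rw [h2]
  exact eLpNorm_sum_le (fun k _ => ((τ.memLp_comp_iterate hf k).sub
    (τ₀.memLp_comp_iterate hf k)).aestronglyMeasurable) le_rfl

theorem isClosed_birkhoffSum_le {f : X → 𝕜} (hf : MemLp f 1 p) (K : ℝ≥0∞) :
    IsClosed {τ : MPTransformation p | ∀ n, eLpNorm (birkhoffSum τ.toEquiv f n) 1 p ≤ K} := by
  rw [ofPred_forall]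
  refine isClosed_iInter fun n => isClosed_of_closure_subset fun τ₀ hτ₀ => ?_
  refine ENNReal.le_of_forall_pos_le_add fun ε hε _ => ?_
  obtain ⟨τ, hτ, hτK⟩ := mem_closure_iff_nhds.1 hτ₀ _
    (ENNReal.tendsto_nhds_zero.1 (tendsto_eLpNorm_birkhoffSum_sub τ₀ hf n) ε
      (ENNReal.coe_pos.2 hε))
  have h1 := τ.memLp_birkhoffSum hf n
  have h2 := τ₀.memLp_birkhoffSum hf n
  calc eLpNorm (birkhoffSum τ₀.toEquiv f n) 1 p
      = eLpNorm (birkhoffSum τ.toEquiv f n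
          - (birkhoffSum τ.toEquiv f n - birkhoffSum τ₀.toEquiv f n)) 1 p := by
        rw [sub_sub_cancel]
    _ ≤ _ := eLpNorm_sub_le h1.aestronglyMeasurable (h1.sub h2).aestronglyMeasurable le_rfl
    _ ≤ K + ε := add_le_add hτK hτ

end MPTransformation

/-! ### Coboundaries and bounded Birkhoff sums -/

theorem IsCoboundary.exists_birkhoffSum_le {X 𝕜 : Type*} [MeasurableSpace X] [RCLike 𝕜]
    {p : Measure X} {f : X → 𝕜} {τ : MPTransformation p} (h : IsCoboundary f 1 τ) :
    ∃ K : ℕ, ∀ n, eLpNorm (birkhoffSum τ.toEquiv f n) 1 p ≤ K := by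
  obtain ⟨h, hh, he⟩ := h
  have hfin : eLpNorm h 1 p + eLpNorm h 1 p ≠ ∞ :=
    ENNReal.add_ne_top.2 ⟨hh.eLpNorm_ne_top, hh.eLpNorm_ne_top⟩
  obtain ⟨K, hK⟩ := ENNReal.exists_nat_gt hfin
  refine ⟨K, fun n => ?_⟩
  have hn := τ.measurePreserving.iterate n
  have h1 : birkhoffSum τ.toEquiv f n =ᵐ[p] h - h ∘ τ.toEquiv^[n] := by
    have h2 : ∀ᵐ x ∂p, ∀ k, f (τ.toEquiv^[k] x)
        = h (τ.toEquiv^[k] x) - h (τ.toEquiv (τ.toEquiv^[k] x)) :=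
      ae_all_iff.2 fun k =>
        (τ.measurePreserving.iterate k).quasiMeasurePreserving.ae he
    filter_upwards [h2] with x hx
    simp only [birkhoffSum, hx, ← Function.iterate_succ_apply', Pi.sub_apply, Function.comp_apply]
    rw [Finset.sum_range_sub' (fun k => h (τ.toEquiv^[k] x)), Function.iterate_zero, id_eq]
  rw [eLpNorm_congr_ae h1]
  refine (eLpNorm_sub_le hh.aestronglyMeasurable
    (hh.aestronglyMeasurable.comp_measurePreserving hn) le_rfl).trans ?_
  rw [eLpNorm_comp_measurePreserving hh.aestronglyMeasurable hn]
  exact hK.le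

theorem birkhoffSum_ae_congr {X E : Type*} [MeasurableSpace X] [AddCommMonoid E] {p : Measure X}
    {τ : X → X} (hτ : MeasurePreserving τ p p) {f g : X → E} (h : f =ᵐ[p] g) (n : ℕ) :
    birkhoffSum τ f n =ᵐ[p] birkhoffSum τ g n := by
  filter_upwards [ae_all_iff.2 fun k => (hτ.iterate k).quasiMeasurePreserving.ae h] with x hx
  exact Finset.sum_congr rfl fun k _ => hx k

theorem exists_transfer_of_birkhoffSum_bounded_of_memLp {X : Type*} [MeasurableSpace X]
    {p : Measure X} [IsProbabilityMeasure p] {τ : X → X} (hτ : MeasurePreserving τ p p)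
    {f : X → ℝ} (hf : MemLp f 1 p) {K : ℝ≥0∞} (hK : K ≠ ∞)
    (hb : ∀ n, eLpNorm (birkhoffSum τ f n) 1 p ≤ K) :
    ∃ h : X → ℝ, MemLp h 1 p ∧ f =ᵐ[p] fun x => h x - h (τ x) := by
  have hmk := hf.aestronglyMeasurable.ae_eq_mk
  obtain ⟨h, hh, he⟩ := exists_transfer_of_birkhoffSum_bounded hτ
    hf.aestronglyMeasurable.stronglyMeasurable_mk.measurable hK (fun n => by
      rw [← eLpNorm_congr_ae (birkhoffSum_ae_congr hτ hmk n)]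
      exact hb n)
  exact ⟨h, hh, hmk.trans he⟩

/-- An integrable function is a coboundary with an integrable transfer function if and only if its
Birkhoff sums are bounded in `L¹`. -/
theorem isCoboundary_one_iff {X 𝕜 : Type*} [MeasurableSpace X] [RCLike 𝕜] {p : Measure X}
    [IsProbabilityMeasure p] {f : X → 𝕜} (hf : MemLp f 1 p) {τ : MPTransformation p} :
    IsCoboundary f 1 τ ↔ ∃ K : ℕ, ∀ n, eLpNorm (birkhoffSum τ.toEquiv f n) 1 p ≤ K := by
  refine ⟨fun h => h.exists_birkhoffSum_le, ?_⟩
  rintro ⟨K, hK⟩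
  have hre : ∀ n, eLpNorm (birkhoffSum τ.toEquiv (fun x => RCLike.re (f x)) n) 1 p ≤ K :=
    fun n => by
      refine (eLpNorm_mono (g := birkhoffSum τ.toEquiv f n) fun x => ?_).trans (hK n)
      have h1 : birkhoffSum τ.toEquiv (fun x => RCLike.re (f x)) n x
          = RCLike.re (birkhoffSum τ.toEquiv f n x) := by simp only [birkhoffSum, map_sum]
      rw [h1]
      exact RCLike.norm_re_le_norm _
  have him : ∀ n, eLpNorm (birkhoffSum τ.toEquiv (fun x => RCLike.im (f x)) n) 1 p ≤ K :=
    fun n => by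
      refine (eLpNorm_mono (g := birkhoffSum τ.toEquiv f n) fun x => ?_).trans (hK n)
      have h1 : birkhoffSum τ.toEquiv (fun x => RCLike.im (f x)) n x
          = RCLike.im (birkhoffSum τ.toEquiv f n x) := by simp only [birkhoffSum, map_sum]
      rw [h1]
      exact RCLike.norm_im_le_norm _
  obtain ⟨u, hu, hue⟩ := exists_transfer_of_birkhoffSum_bounded_of_memLp τ.measurePreserving hf.re
    (ENNReal.natCast_ne_top K) hre
  obtain ⟨v, hv, hve⟩ := exists_transfer_of_birkhoffSum_bounded_of_memLp τ.measurePreserving hf.im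
    (ENNReal.natCast_ne_top K) him
  have hu' : MemLp (fun x => (u x : 𝕜)) 1 p := hu.ofReal
  have hv' : MemLp (fun x => (RCLike.I : 𝕜) * (v x : 𝕜)) 1 p := hv.ofReal.const_mul RCLike.I
  refine ⟨fun x => (u x : 𝕜) + RCLike.I * (v x : 𝕜), hu'.add hv', ?_⟩
  filter_upwards [hue, hve] with x h1 h2
  rw [← RCLike.re_add_im (f x), h1, h2]
  push_cast
  ring

/-- The coboundary condition is the union over `K` of the closed conditions `∀ n, ‖S_n‖₁ ≤ K`. -/
theorem isGδ_not_isCoboundary {X 𝕜 : Type*} [MeasurableSpace X] [RCLike 𝕜] {p : Measure X}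
    [IsProbabilityMeasure p] {f : X → 𝕜} (hf : MemLp f 1 p) :
    IsGδ {T : MPAut p | ¬ T.IsCoboundary f 1} := by
  let C : ℕ → Set (MPTransformation p) := fun K =>
    {τ | ∀ n, eLpNorm (birkhoffSum τ.toEquiv f n) 1 p ≤ K}
  have hC : ∀ K, IsClosed (C K) := fun K => MPTransformation.isClosed_birkhoffSum_le hf K
  let q : MPTransformation p → MPAut p := Quotient.mk (MPTransformation.aeSetoid p)
  -- A closed set of transformations is a union of classes, so its image is closed.
  have hpre : ∀ K, q ⁻¹' (q '' C K) = C K := fun K => by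
    refine Subset.antisymm ?_ (subset_preimage_image q _)
    rintro τ ⟨σ, hσ, hστ⟩
    exact ((MPTransformation.inseparable_of_ae_eq (Quotient.exact hστ)).mem_closed_iff (hC K)).1 hσ
  have hclosed : ∀ K, IsClosed (q '' C K) := fun K =>
    (isQuotientMap_quot_mk.isClosed_preimage (s := q '' C K)).1 (by
      rw [show Quot.mk _ ⁻¹' (q '' C K) = q ⁻¹' (q '' C K) from rfl, hpre]; exact hC K)
  have hset : {T : MPAut p | ¬ T.IsCoboundary f 1} = ⋂ K, (q '' C K)ᶜ := by
    ext T
    induction T using Quotient.inductionOn with | _ τ => ?_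
    have h1 : ∀ K, q τ ∈ q '' C K ↔ τ ∈ C K := fun K => by
      rw [← mem_preimage, hpre]
    have h2 : (q τ).IsCoboundary f 1 ↔ ∃ K, τ ∈ C K := isCoboundary_one_iff hf
    change ¬ (q τ).IsCoboundary f 1 ↔ q τ ∈ ⋂ K, (q '' C K)ᶜ
    simp only [mem_iInter, mem_compl_iff, h1, h2, not_exists]
  rw [hset]
  exact IsGδ.iInter_of_isOpen fun K => (hclosed K).isOpen_compl

/-! ### Density -/

theorem IsNonatomic.exists_subset_measure_lt {X : Type*} [MeasurableSpace X] {p : Measure X}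
    [IsFiniteMeasure p] (hp : IsNonatomic p) {A : Set X} (hA : MeasurableSet A) (hA0 : 0 < p A)
    {ε : ℝ≥0∞} (hε : 0 < ε) : ∃ B ⊆ A, MeasurableSet B ∧ 0 < p B ∧ p B < ε := by
  -- One of two complementary parts has at most half the measure.
  have key : ∀ n : ℕ, ∃ B ⊆ A, MeasurableSet B ∧ 0 < p B ∧ 2 ^ n * p B ≤ p A := by
    intro n
    induction n with
    | zero => exact ⟨A, Subset.rfl, hA, hA0, by simp⟩
    | succ n ih =>
      obtain ⟨B, hBA, hB, hB0, hBn⟩ := ih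
      obtain ⟨C, hCB, hC, hC0, hClt⟩ := hp B hB hB0
      have hsum : p C + p (B \ C) = p B := by
        rw [← measure_inter_add_sdiff B hC, inter_eq_self_of_subset_right hCB]
      have hD0 : 0 < p (B \ C) := by
        rw [pos_iff_ne_zero]
        intro h0
        rw [h0, add_zero] at hsum
        exact hClt.ne hsum
      rcases le_total (p C) (p (B \ C)) with h | h
      · refine ⟨C, hCB.trans hBA, hC, hC0, le_trans ?_ hBn⟩
        rw [pow_succ, mul_assoc, two_mul, ← hsum]
        gcongr
      · refine ⟨B \ C, sdiff_subset.trans hBA, hB.diff hC, hD0, le_trans ?_ hBn⟩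
        rw [pow_succ, mul_assoc, two_mul, ← hsum]
        gcongr
  obtain ⟨n, hn⟩ := ENNReal.exists_nat_mul_gt hε.ne' (measure_ne_top p A)
  obtain ⟨B, hBA, hB, hB0, hBn⟩ := key n
  refine ⟨B, hBA, hB, hB0, ?_⟩
  by_contra! h
  refine absurd (hBn.trans_lt hn) (not_lt.2 ?_)
  gcongr
  exact_mod_cast n.lt_two_pow_self.le

namespace MPTransformation

variable {X 𝕜 : Type*} [MeasurableSpace X] [RCLike 𝕜] {p : Measure X}

/-- A measurable isomorphism that is cut and pasted from countably many measure-preserving ones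
preserves the measure. -/
theorem measurePreserving_of_piecewise {ι : Type*} [Countable ι] (e : X ≃ᵐ X) (k : X → ι)
    (hk : ∀ i, MeasurableSet (k ⁻¹' {i})) (g : ι → X ≃ᵐ X)
    (hg : ∀ i, MeasurePreserving (g i) p p) (he : ∀ x, e x = g (k x) x) :
    MeasurePreserving e p p := by
  have himage : ∀ B, MeasurableSet B → p (e '' B) = p B := by
    intro B hB
    have hcover : B = ⋃ i, B ∩ k ⁻¹' {i} := by
      ext x; simp
    have hdisj : Pairwise (Function.onFun Disjoint fun i => B ∩ k ⁻¹' {i}) := fun i j hij =>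
      disjoint_left.2 fun x hx hx' => hij (hx.2.symm.trans hx'.2)
    have hm : ∀ i, MeasurableSet (B ∩ k ⁻¹' {i}) := fun i => hB.inter (hk i)
    have hpiece : ∀ i, p (e '' (B ∩ k ⁻¹' {i})) = p (B ∩ k ⁻¹' {i}) := fun i => by
      have : e '' (B ∩ k ⁻¹' {i}) = g i '' (B ∩ k ⁻¹' {i}) :=
        image_congr fun x hx => by rw [he, show k x = i from hx.2]
      rw [this, ← (hg i).measure_preimage_equiv, (g i).injective.preimage_image]
    rw [hcover, image_iUnion, measure_iUnion _ fun i => e.measurableSet_image.2 (hm i),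
      measure_iUnion hdisj hm]
    · exact tsum_congr hpiece
    · exact fun i j hij => (disjoint_image_iff e.injective).2 (hdisj hij)
  refine ⟨e.measurable, Measure.ext fun B hB => ?_⟩
  rw [Measure.map_apply e.measurable hB, ← himage _ (e.measurable hB),
    image_preimage_eq _ e.surjective]

/-- If `A` is disjoint from `τ⁻¹ A`, exchanging the two sets before applying `τ` makes `τ` the
identity on `A`, and changes it only on `A ∪ τ⁻¹ A`. -/
theorem exists_eq_id_on (τ : MPTransformation p) {A : Set X} (hA : MeasurableSet A)
    (hτA : ∀ x ∈ A, τ.toEquiv x ∉ A) :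
    ∃ σ : MPTransformation p, (∀ x ∈ A, σ.toEquiv x = x) ∧
      ∀ x ∉ A ∪ τ.toEquiv ⁻¹' A, σ.toEquiv x = τ.toEquiv x := by
  classical
  set t := τ.toEquiv with ht
  let s : X → X := fun x => if x ∈ A then t.symm x else if t x ∈ A then t x else x
  have hs : Function.Involutive s := by
    intro x
    by_cases h1 : x ∈ A
    · have h2 : t.symm x ∉ A := fun h => hτA _ h (by simpa using h1)
      simp [s, h1, h2]
    · by_cases h2 : t x ∈ A <;> simp [s, h1, h2]
  have hA' : MeasurableSet (t ⁻¹' A) := t.measurable hA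
  have hsm : Measurable s :=
    Measurable.ite hA t.symm.measurable (Measurable.ite hA' t.measurable measurable_id)
  let e : X ≃ᵐ X := ⟨hs.toPerm, hsm, hsm⟩
  let k : X → Fin 3 := fun x => if x ∈ A then 0 else if t x ∈ A then 1 else 2
  have hkm : Measurable k :=
    Measurable.ite hA measurable_const (Measurable.ite hA' measurable_const measurable_const)
  have hmp : MeasurePreserving e p p := by
    refine measurePreserving_of_piecewise e k (fun i => hkm (measurableSet_singleton i))
      ![t.symm, t, MeasurableEquiv.refl X] (fun i => ?_) fun x => ?_
    · fin_cases i
      · exact τ.measurePreserving.symm t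
      · exact τ.measurePreserving
      · exact MeasurePreserving.id p
    · change s x = _
      by_cases h1 : x ∈ A
      · simp [s, k, h1]
      · by_cases h2 : t x ∈ A <;> simp [s, k, h1, h2]
  refine ⟨⟨e.trans t, τ.measurePreserving.comp hmp⟩, fun x hx => ?_, fun x hx => ?_⟩
  · change t (s x) = x
    simp [s, hx]
  · change t (s x) = t x
    simp only [mem_union, mem_preimage, not_or] at hx
    simp [s, hx.1, hx.2]

/-- If `f` is a coboundary, some set of positive measure on which `f` does not vanish is disjoint
from its preimage: otherwise the transfer function would be invariant where `f` does not vanish. -/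
theorem exists_disjoint_preimage_of_isCoboundary {f : X → 𝕜} (hf0 : ¬ f =ᵐ[p] 0)
    {τ : MPTransformation p} (h : IsCoboundary f 1 τ) :
    ∃ A, MeasurableSet A ∧ 0 < p A ∧ (∀ᵐ x ∂p, x ∈ A → f x ≠ 0) ∧
      ∀ x ∈ A, τ.toEquiv x ∉ A := by
  obtain ⟨h, hh, he⟩ := h
  set u := hh.aestronglyMeasurable.mk h with hu
  have hum : Measurable u := hh.aestronglyMeasurable.stronglyMeasurable_mk.measurable
  have hue : h =ᵐ[p] u := hh.aestronglyMeasurable.ae_eq_mk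
  have hfu : ∀ᵐ x ∂p, f x = u x - u (τ.toEquiv x) := by
    filter_upwards [he, hue, τ.measurePreserving.quasiMeasurePreserving.ae hue] with x h1 h2 h3
    rw [h1, h2, h3]
  let b := TopologicalSpace.countableBasis 𝕜
  have hb := TopologicalSpace.isBasis_countableBasis 𝕜
  let A : Set 𝕜 → Set X := fun V => {x | u x ∈ V ∧ u (τ.toEquiv x) ∉ V}
  have hpos : ∃ V ∈ b, 0 < p (A V) := by
    by_contra! hcon
    refine hf0 ?_
    have h0 : ∀ᵐ x ∂p, ∀ V ∈ b, x ∉ A V :=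
      (ae_ball_iff (TopologicalSpace.countable_countableBasis 𝕜)).2 fun V hV =>
        measure_eq_zero_iff_ae_notMem.1 (nonpos_iff_eq_zero.1 (hcon V hV))
    filter_upwards [hfu, h0] with x h1 h2
    rw [h1, Pi.zero_apply, sub_eq_zero]
    by_contra hne
    obtain ⟨V, hV, hxV, hVs⟩ := hb.exists_subset_of_mem_open (a := u x)
      (u := {u (τ.toEquiv x)}ᶜ) hne isOpen_compl_singleton
    exact h2 V hV ⟨hxV, fun h3 => hVs h3 rfl⟩
  obtain ⟨V, hV, hVpos⟩ := hpos
  have hVm : MeasurableSet V := (hb.isOpen hV).measurableSet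
  refine ⟨A V, (hum hVm).inter ((hum.comp τ.toEquiv.measurable) hVm).compl, hVpos, ?_,
    fun x hx hx' => hx.2 hx'.1⟩
  filter_upwards [hfu] with x hx hxA h0
  rw [hx, sub_eq_zero] at h0
  exact hxA.2 (h0 ▸ hxA.1)

/-- A function that does not vanish on a set of fixed points of positive measure is not a
coboundary. -/
theorem not_isCoboundary_of_eq_id_on {f : X → 𝕜} {s : ℝ≥0∞} {τ : MPTransformation p} {A : Set X}
    (hA0 : 0 < p A) (hfA : ∀ᵐ x ∂p, x ∈ A → f x ≠ 0) (hτ : ∀ x ∈ A, τ.toEquiv x = x) :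
    ¬ IsCoboundary f s τ := by
  rintro ⟨h, -, he⟩
  refine hA0.ne' (measure_eq_zero_iff_ae_notMem.2 ?_)
  filter_upwards [he, hfA] with x h1 h2 hx
  refine h2 hx ?_
  rw [h1, hτ x hx, sub_self]

theorem dense_not_isCoboundary [IsFiniteMeasure p] (hp : IsNonatomic p) {f : X → 𝕜}
    (hf0 : ¬ f =ᵐ[p] 0) : Dense {τ : MPTransformation p | ¬ IsCoboundary f 1 τ} := by
  intro τ
  by_cases hτ : IsCoboundary f 1 τ
  swap
  · exact subset_closure hτ
  obtain ⟨A, hA, hA0, hfA, hτA⟩ := exists_disjoint_preimage_of_isCoboundary hf0 hτ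
  choose B hBA hB hB0 hBlt using fun n : ℕ =>
    hp.exists_subset_measure_lt hA hA0 (ε := ((n : ℝ≥0∞) + 1)⁻¹) (by simp)
  choose σ hσ hσ' using fun n =>
    τ.exists_eq_id_on (hB n) fun x hx hx' => hτA x (hBA n hx) (hBA n hx')
  have hlim : Tendsto (fun n : ℕ => 2 * ((n : ℝ≥0∞) + 1)⁻¹) atTop (𝓝 (2 * 0)) := by
    refine ENNReal.Tendsto.const_mul ?_ (Or.inr (by simp))
    exact_mod_cast (tendsto_add_atTop_iff_nat 1).2 ENNReal.tendsto_inv_nat_nhds_zero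
  rw [mul_zero] at hlim
  refine mem_closure_of_tendsto (b := atTop) (tendsto_of_agree_off hσ' ?_)
    (Eventually.of_forall fun n =>
    not_isCoboundary_of_eq_id_on (hB0 n) (hfA.mono fun x hx hxB => hx (hBA n hxB)) (hσ n))
  refine tendsto_of_tendsto_of_tendsto_of_le_of_le tendsto_const_nhds hlim
    (fun _ => zero_le) fun n => (measure_union_le _ _).trans ?_
  rw [τ.measurePreserving.measure_preimage_equiv, two_mul]
  exact add_le_add (hBlt n).le (hBlt n).le

end MPTransformation

/-! ### The generic transformation -/

theorem mainTheorem6 {X 𝕜 : Type*} [MeasurableSpace X] [RCLike 𝕜] (p : Measure X)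
    [IsProbabilityMeasure p] (hp : IsNonatomic p) (r : ℝ≥0∞) (hr : 1 ≤ r)
    (f : X → 𝕜) (hf : MemLp f r p) (hf0 : ¬ f =ᵐ[p] 0) (hfint : ∫ x, f x ∂p = 0) :
    IsGδ {T : MPAut p | ¬ T.IsCoboundary f 1} ∧ Dense {T : MPAut p | ¬ T.IsCoboundary f 1} := by
  refine ⟨isGδ_not_isCoboundary (hf.mono_exponent hr), ?_⟩
  have hq := isQuotientMap_quotient_mk' (s := MPTransformation.aeSetoid p)
  refine (hq.surjective.denseRange.dense_image hq.continuous
    (MPTransformation.dense_not_isCoboundary hp hf0)).mono ?_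
  rintro _ ⟨τ, hτ, rfl⟩
  exact hτ
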